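/- Let $G$ be a finite simple undirected graph with vertex set $V$, and let $N(i)$ denote the set of neighbors of a vertex $i$. For $x\in\{0,1\}^V$ and $A\subseteq V$ let $x|_A$ denote the restriction of $x$ to $A$. Let $\beta_1(G)$ be the minimum length of a (not necessarily linear) binary index code for $G$, i.e., the smallest integer $\ell\ge 0$ for which there exist a function $E:\{0,1\}^V\to\{0,1\}^\ell$ and functions $D^{(i)}:\{0,1\}^\ell\times\{0,1\}^{N(i)}\to\{0,1\}$ ($i\in V$) such that $D^{(i)}(E(x),x|_{N(i)})=x_i$ for all $x\in\{0,1\}^V$ and $i\in V$. A (not necessarily linear) task-based embedded index code for $G$ consists of a set $S\subseteq V$, integers $\ell_j\ge 0$ and functions $E^{(j)}:\{0,1\}^{N(j)}\to\{0,1\}^{\ell_j}$ for $j\in S$, vertices $j_i\in S$ for $i\in V$, and functions $D^{(i)}:\{0,1\}^{\ell_{j_i}}\times\{0,1\}^{N(i)}\to\{0,1\}$ for $i\in V$, such that $D^{(i)}\big(E^{(j_i)}(x|_{N(j_i)}),x|_{N(i)}\big)=x_i$ for all $x\in\{0,1\}^V$ and $i\in V$. Its total length is $\sum_{j\in S}\ell_j$.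 For an integer $k\ge 1$ let $G_k$ be the graph with vertex set $\{(u,v)\in\mathbb{F}_2^k\times\mathbb{F}_2^k : \langle u,v\rangle=1\}$ in which $(u_1,v_1)$ and $(u_2,v_2)$ are adjacent if and only if $\langle u_1,v_2\rangle=\langle v_1,u_2\rangle=0$, and let $\overline{G_k}$ be its complement. **Proposition.** There exist absolute constants $c,C>0$ such that for every integer $k\ge 0$ there exists a finite graph $G$ with $\beta_1(G)=k$ which admits a task-based embedded index code and for which the minimum total length $\ell$ of a (not necessarily linear) task-based embedded index code satisfies $c\,k^2\le \ell\le C\,k^2$ (that is, $\ell=\Theta(k^2)$). Moreover, for every $k\ge 2$ this holds, with the same constants, for the graph $G=\overline{G_k}$. -/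

import Mathlib

/-- A (not necessarily linear) binary index code of length `ℓ` for the side information graph `G`:
receiver `i` wants the bit `x i` and knows the bits of its neighbors in `G`. -/
structure IndexCode {V : Type*} (G : SimpleGraph V) (ℓ : ℕ) where
  encode : (V → Bool) → (Fin ℓ → Bool)
  decode : (i : V) → (Fin ℓ → Bool) → (G.neighborSet i → Bool) → Bool
  correct : ∀ (x : V → Bool) (i : V), decode i (encode x) (fun j => x j) = x i

/-- A (not necessarily linear) binary task-based embedded index code for `G`: every sender `j ∈ S`
broadcasts `len j` bits computed from the bits of its neighbors in `G`, and every receiver `i`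
retrieves `x i` from the broadcast of the single sender `sender i` and from the bits
of its own neighbors. -/
structure TaskBasedCode {V : Type*} (G : SimpleGraph V) where
  S : Finset V
  len : S → ℕ
  encode : (j : S) → (G.neighborSet (j : V) → Bool) → (Fin (len j) → Bool)
  sender : V → S
  decode : (i : V) → (Fin (len (sender i)) → Bool) → (G.neighborSet i → Bool) → Bool
  correct : ∀ (x : V → Bool) (i : V),
    decode i (encode (sender i) (fun j => x j)) (fun j => x j) = x i

/-- The total number of bits broadcast by all the senders. -/
def TaskBasedCode.totalLength {V : Type*} {G : SimpleGraph V} (C : TaskBasedCode G) : ℕ :=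
  ∑ j : C.S, C.len j

/-- The parameter `β₁(G)`: the minimum length of an index code for `G` (over a finite vertex set
the set of lengths is nonempty, see `exists_indexCode`). -/
noncomputable def beta1 {V : Type*} (G : SimpleGraph V) : ℕ :=
  sInf {ℓ : ℕ | Nonempty (IndexCode G ℓ)}

theorem exists_indexCode {V : Type*} [Finite V] (G : SimpleGraph V) :
    {ℓ : ℕ | Nonempty (IndexCode G ℓ)}.Nonempty :=
  ⟨Nat.card V, ⟨{
    encode := fun x m => x ((Finite.equivFin V).symm m)
    decode := fun i y _ => y (Finite.equivFin V i)
    correct := fun x i => by simp }⟩⟩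

/-- `ℓ` is the minimum total length of a task-based embedded index code for `G`; in particular
such a code exists. -/
def IsMinTaskBasedLength {V : Type*} (G : SimpleGraph V) (ℓ : ℕ) : Prop :=
  IsLeast (Set.range fun C : TaskBasedCode G => C.totalLength) ℓ

/-- The graph `G_k`: its vertices are the pairs `(u, v)` of vectors in `𝔽₂ᵏ` with `⟨u, v⟩ = 1`, and
`(u₁, v₁)`, `(u₂, v₂)` are adjacent iff `⟨u₁, v₂⟩ = ⟨v₁, u₂⟩ = 0`. -/
def peetersGraph (k : ℕ) :
    SimpleGraph {p : (Fin k → ZMod 2) × (Fin k → ZMod 2) // dotProduct p.1 p.2 = 1} where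
  Adj x y := dotProduct x.1.1 y.1.2 = 0 ∧ dotProduct x.1.2 y.1.1 = 0
  symm := ⟨fun x y h =>
    ⟨(dotProduct_comm _ _).trans h.2, (dotProduct_comm _ _).trans h.1⟩⟩
  loopless := ⟨fun x h => one_ne_zero (x.2.symm.trans h.1)⟩

/-!
The upper bounds come from the representation of the complement of `G_k` by the vectors `u`, `v` of
its vertices: the sum of `x_w u_w` over a set of vertices `w` containing `i = (u, v)`, paired with
`v`, is `x_i` plus bits of neighbors of `i`. Summing over all vertices gives an index code of length
`k` (`Represents.nonempty_indexCode`), and summing over the neighborhoods of a total dominating set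
of at most `2k` vertices gives a task-based code of length at most `2k²`
(`exists_taskBasedCode_peeters`). The `k` independent vertices `(eᵢ, eᵢ)` give `β₁ ≥ k`.

For the lower bound (`sq_le_totalLength_peeters`), let `q` be about `k / 32` and suppose that a
task-based code has total length below `q²`. Fewer than `q` senders use `q` bits or more, and a
sender serves only its neighbors, so all pairs `(u, v)` with `⟨u, v⟩ = 1` that satisfy the `2q` or
fewer linear equations expressing nonadjacency to these senders are left to senders of fewer than
`q` bits. By Lindsey's lemma there are at least `2 ^ (2k - 2q)` such pairs
(`two_pow_le_card_uncovered`), so one of the at most `q² ≤ 2 ^ (2q)` remaining senders serves at least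
`2 ^ (2k - 4q)` of them. On the other hand `G_k` is pseudorandom: by a second moment computation
(`sum_sq_deviation_le`), every set `R` of at least about `2 ^ (3k/2)` vertices contains one that is
adjacent to an eighth of `R`, and iterating this produces a clique of `q` vertices (`exists_clique`)
in the set served by that one sender. This clique is an independent set of the complement, which
forces the sender to use at least `q` bits, a contradiction.

For `k = 0` and `k = 1` the empty graph and the complete graph on two vertices take the place of the
complement of `G_k`.
-/

/-! ### Index codes from vectors and lower bounds from independent sets -/

/-- The bit `b` as an element of `𝔽₂`. -/
def bitToZMod (b : Bool) : ZMod 2 := if b then 1 else 0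

/-- The element `a` of `𝔽₂` as a bit. -/
def zmodToBit (a : ZMod 2) : Bool := decide (a = 1)

theorem bitToZMod_injective : Function.Injective bitToZMod := by
  unfold bitToZMod; decide

theorem zmodToBit_injective : Function.Injective zmodToBit := by
  unfold zmodToBit; decide

/-- A receiver can decode as soon as what it sees determines the bit it wants. -/
theorem exists_decode {X Y Z : Type*} (f : X → Y) (g : X → Z) (t : X → Bool)
    (h : ∀ x y, f x = f y → g x = g y → t x = t y) :
    ∃ d : Y → Z → Bool, ∀ x, d (f x) (g x) = t x := by
  have hF : Function.FactorsThrough t (fun x => (f x, g x)) := fun x y hxy =>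
    h x y (congrArg Prod.fst hxy) (congrArg Prod.snd hxy)
  exact ⟨fun y z => Function.extend (fun x => (f x, g x)) t (fun _ => false) (y, z),
    fun x => hF.extend_apply (fun _ => false) x⟩

/-- `a` and `b` are the two halves of a representation of the complement of `G` over `𝔽₂` by vectors
of length `k`: the matrix `(⟨a j, b i⟩)` fits the side information graph `G`. -/
def Represents {V : Type*} (G : SimpleGraph V) {k : ℕ} (a b : V → Fin k → ZMod 2) : Prop :=
  (∀ i, dotProduct (a i) (b i) = 1) ∧
    ∀ i j, i ≠ j → ¬ G.Adj i j → dotProduct (a j) (b i) = 0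

/-- The sum of the vectors `a w` over the positions `w` of the ones of `x`, for `w` in an injective
family containing `i`, together with the bits of the neighbors of `i` determines `x i`:
pair the sum with `b i`. -/
theorem Represents.determines {V ι : Type*} [Fintype ι] {G : SimpleGraph V} {k : ℕ}
    {a b : V → Fin k → ZMod 2} (hab : Represents G a b) (e : ι → V) (he : Function.Injective e)
    (i₀ : ι) (x y : V → Bool)
    (hE : ∀ m, ∑ w, bitToZMod (x (e w)) * a (e w) m = ∑ w, bitToZMod (y (e w)) * a (e w) m)
    (hN : ∀ j, G.Adj (e i₀) j → x j = y j) : x (e i₀) = y (e i₀) := by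
  classical
  have hsum : ∀ z : V → Bool,
      ∑ m, (∑ w, bitToZMod (z (e w)) * a (e w) m) * b (e i₀) m =
        ∑ w, bitToZMod (z (e w)) * dotProduct (a (e w)) (b (e i₀)) := by
    intro z
    simp only [dotProduct, Finset.sum_mul, Finset.mul_sum]
    rw [Finset.sum_comm]
    exact Finset.sum_congr rfl fun w _ => Finset.sum_congr rfl fun m _ => mul_assoc _ _ _
  have h0 : ∑ w, (bitToZMod (x (e w)) - bitToZMod (y (e w))) *
      dotProduct (a (e w)) (b (e i₀)) = 0 := by
    simp only [sub_mul, Finset.sum_sub_distrib]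
    rw [← hsum, ← hsum, sub_eq_zero]
    exact Finset.sum_congr rfl fun m _ => by rw [hE m]
  rw [Finset.sum_eq_single i₀] at h0
  · rw [hab.1, mul_one, sub_eq_zero] at h0
    exact bitToZMod_injective h0
  · intro w _ hw
    by_cases hadj : G.Adj (e i₀) (e w)
    · rw [hN _ hadj, sub_self, zero_mul]
    · rw [hab.2 _ _ (fun h => hw (he h).symm) hadj, mul_zero]
  · simp

theorem Represents.nonempty_indexCode {V : Type*} [Fintype V] {G : SimpleGraph V} {k : ℕ}
    {a b : V → Fin k → ZMod 2} (hab : Represents G a b) : Nonempty (IndexCode G k) := by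
  let E : (V → Bool) → (Fin k → Bool) := fun x m =>
    zmodToBit (∑ w, bitToZMod (x w) * a w m)
  have hdec : ∀ i : V, ∃ d : (Fin k → Bool) → (G.neighborSet i → Bool) → Bool,
      ∀ x : V → Bool, d (E x) (fun j => x j) = x i := by
    intro i
    refine exists_decode E (fun x (j : G.neighborSet i) => x j) (fun x => x i) ?_
    intro x y hE hN
    exact hab.determines id Function.injective_id i x y
      (fun m => zmodToBit_injective (congrFun hE m))
      (fun j hj => congrFun hN ⟨j, hj⟩)
  choose d hd using hdec
  exact ⟨⟨E, d, fun x i => hd i x⟩⟩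

/-- If every vertex has a neighbor in `S`, the members of `S` can serve everybody by sending `k` bits
each: a sender sums the representing vectors over its own neighborhood. -/
theorem Represents.exists_taskBasedCode {V : Type*} [Finite V] {G : SimpleGraph V} {k : ℕ}
    {a b : V → Fin k → ZMod 2} (hab : Represents G a b) (S : Finset V)
    (hS : ∀ i, ∃ j ∈ S, G.Adj j i) : ∃ C : TaskBasedCode G, C.totalLength = S.card * k := by
  classical
  have := Fintype.ofFinite V
  choose s hs hadj using hS
  let E : (j : S) → (G.neighborSet (j : V) → Bool) → (Fin k → Bool) := fun j y m =>
    zmodToBit (∑ w, bitToZMod (y w) * a w m)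
  have hdec : ∀ i : V, ∃ d : (Fin k → Bool) → (G.neighborSet i → Bool) → Bool,
      ∀ x : V → Bool, d (E ⟨s i, hs i⟩ (fun j => x j)) (fun j => x j) = x i := by
    intro i
    refine exists_decode (fun x : V → Bool => E ⟨s i, hs i⟩ (fun j => x j))
      (fun x (j : G.neighborSet i) => x j) (fun x => x i) ?_
    intro x y hE hN
    exact hab.determines (fun w : G.neighborSet (s i) => (w : V)) Subtype.val_injective
      ⟨i, hadj i⟩ x y (fun m => zmodToBit_injective (congrFun hE m))
      (fun j hj => congrFun hN ⟨j, hj⟩)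
  choose d hd using hdec
  exact ⟨⟨S, fun _ => k, E, fun i => ⟨s i, hs i⟩, d, fun x i => hd i x⟩,
    by simp [TaskBasedCode.totalLength]⟩

/-- The words supported on an independent set `s` all look alike to the receivers in `s`, so an
encoding that serves these receivers separates them. -/
theorem card_le_of_independent {V : Type*} {G : SimpleGraph V} {ℓ : ℕ}
    (E : (V → Bool) → (Fin ℓ → Bool)) (s : Finset V)
    (hind : ∀ i ∈ s, ∀ j ∈ s, ¬ G.Adj i j)
    (hE : ∀ i ∈ s, ∀ x y : V → Bool, E x = E y → (∀ j, G.Adj i j → x j = y j) → x i = y i) :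
    s.card ≤ ℓ := by
  classical
  let emb : (s → Bool) → (V → Bool) := fun z v => if h : v ∈ s then z ⟨v, h⟩ else false
  have hinj : Function.Injective fun z => E (emb z) := by
    intro z z' hzz
    funext i
    have := hE i i.2 (emb z) (emb z') hzz (fun j hj => by
      have : j ∉ s := fun h => hind i i.2 j h hj
      simp [emb, this])
    simpa [emb] using this
  have hc := Fintype.card_le_of_injective _ hinj
  simp only [Fintype.card_fun, Fintype.card_bool, Fintype.card_coe, Fintype.card_fin] at hc
  exact (Nat.pow_le_pow_iff_right (by norm_num)).1 hc

theorem IndexCode.card_le {V : Type*} {G : SimpleGraph V} {ℓ : ℕ} (C : IndexCode G ℓ)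
    (s : Finset V) (hind : ∀ i ∈ s, ∀ j ∈ s, ¬ G.Adj i j) : s.card ≤ ℓ := by
  refine card_le_of_independent C.encode s hind fun i _ x y hE hN => ?_
  rw [← C.correct x i, ← C.correct y i, hE]
  congr 1
  exact funext fun j => hN j j.2

theorem beta1_eq_of_represents {V : Type*} [Fintype V] {G : SimpleGraph V} {k : ℕ}
    {a b : V → Fin k → ZMod 2} (hab : Represents G a b) (s : Finset V)
    (hind : ∀ i ∈ s, ∀ j ∈ s, ¬ G.Adj i j) (hs : s.card = k) : beta1 G = k := by
  refine le_antisymm (Nat.sInf_le hab.nonempty_indexCode) ?_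
  obtain ⟨C⟩ := Nat.sInf_mem (exists_indexCode G)
  exact hs ▸ C.card_le s hind

namespace TaskBasedCode

variable {V : Type*} {G : SimpleGraph V} (C : TaskBasedCode G)

theorem eq_of_encode_eq (i : V) (x y : V → Bool)
    (hE : C.encode (C.sender i) (fun j => x j) = C.encode (C.sender i) (fun j => y j))
    (hN : ∀ j, G.Adj i j → x j = y j) : x i = y i := by
  rw [← C.correct x i, ← C.correct y i, hE]
  congr 1
  exact funext fun j => hN j j.2

theorem card_le_len (j : C.S) (s : Finset V) (hind : ∀ i ∈ s, ∀ i' ∈ s, ¬ G.Adj i i')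
    (hs : ∀ i ∈ s, C.sender i = j) : s.card ≤ C.len j := by
  refine card_le_of_independent (fun x : V → Bool => C.encode j (fun v => x v)) s hind ?_
  intro i hi x y hE hN
  have hj := hs i hi
  subst hj
  exact C.eq_of_encode_eq i x y hE hN

theorem one_le_len (i : V) : 1 ≤ C.len (C.sender i) := by
  simpa using C.card_le_len (C.sender i) {i} (by simp) (by simp)

/-- A receiver is served by one of its neighbors: nobody else's broadcast depends on its bit. -/
theorem adj_sender (i : V) : G.Adj (C.sender i) i := by
  classical
  by_contra h
  have hne : ∀ j v : V, ¬ G.Adj j i → G.Adj j v → v ≠ i := fun j v hj hv hvi => hj (hvi ▸ hv)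
  have := C.eq_of_encode_eq i (fun _ => false) (Function.update (fun _ => false) i true)
    (by
      congr 1
      funext v
      exact (Function.update_of_ne (hne _ _ h v.2) true (fun _ => false)).symm)
    (fun v hv => (Function.update_of_ne (hne _ _ G.irrefl hv) true (fun _ => false)).symm)
  simp at this

theorem one_le_totalLength (i : V) : 1 ≤ C.totalLength :=
  (C.one_le_len i).trans
    (Finset.single_le_sum (f := C.len) (fun _ _ => Nat.zero_le _) (Finset.mem_univ _))

/-- The number of senders that send at least `q` bits, times `q`, is at most the total length. -/
theorem card_mul_le_totalLength (q : ℕ) :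
    (Finset.univ.filter fun j => q ≤ C.len j).card * q ≤ C.totalLength := by
  calc _ ≤ ∑ j ∈ Finset.univ.filter (fun j => q ≤ C.len j), C.len j := by
        rw [← smul_eq_mul]
        exact Finset.card_nsmul_le_sum _ _ _ fun j hj => (Finset.mem_filter.1 hj).2
    _ ≤ _ := Finset.sum_le_sum_of_subset (Finset.filter_subset _ _)

end TaskBasedCode

theorem exists_isMinTaskBasedLength {V : Type*} {G : SimpleGraph V} (C : TaskBasedCode G) :
    ∃ ℓ, IsMinTaskBasedLength G ℓ :=
  ⟨_, Nat.sInf_mem ⟨_, Set.mem_range_self C⟩, fun _ h => Nat.sInf_le h⟩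

/-! ### Character sums over `𝔽₂ᵏ` -/

/-- The nontrivial character of `𝔽₂`, with integer values. -/
def sgn (a : ZMod 2) : ℤ := if a = 0 then 1 else -1

theorem sgn_add (a b : ZMod 2) : sgn (a + b) = sgn a * sgn b := by
  revert a b; unfold sgn; decide

theorem sum_sgn_dotProduct {k : ℕ} {v : Fin k → ZMod 2} (hv : v ≠ 0) :
    ∑ u, sgn (dotProduct u v) = 0 := by
  obtain ⟨i, hi⟩ := Function.ne_iff.1 hv
  have h1 : sgn (v i) = -1 := if_neg hi
  have h2 : ∑ u, sgn (dotProduct u v) = ∑ u, -sgn (dotProduct u v) :=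
    calc ∑ u, sgn (dotProduct u v) = ∑ u, sgn (dotProduct (u + Pi.single i 1) v) :=
          (Equiv.sum_comp (Equiv.addRight (Pi.single i 1)) fun u => sgn (dotProduct u v)).symm
      _ = ∑ u, -sgn (dotProduct u v) := Finset.sum_congr rfl fun u _ => by
          rw [add_dotProduct, sgn_add, single_one_dotProduct, h1, mul_neg_one]
  rw [Finset.sum_neg_distrib] at h2
  linarith

theorem sum_sgn_mul_sgn {k : ℕ} (v v' : Fin k → ZMod 2) :
    ∑ u, sgn (dotProduct u v) * sgn (dotProduct u v') = if v = v' then 2 ^ k else 0 := by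
  have h : ∀ u, sgn (dotProduct u v) * sgn (dotProduct u v') = sgn (dotProduct u (v + v')) :=
    fun u => by rw [dotProduct_add, sgn_add]
  simp only [h]
  split_ifs with hv
  · subst hv
    rw [show v + v = 0 from funext fun i => CharTwo.add_self_eq_zero (v i)]
    simp [sgn]
  · refine sum_sgn_dotProduct fun h0 => hv ?_
    exact funext fun i => CharTwo.add_eq_zero.1 (congrFun h0 i)

/-- Lindsey's lemma: character sums over a rectangle are small. -/
theorem sq_sum_sgn_le {k : ℕ} (A B : Finset (Fin k → ZMod 2)) :
    (∑ a ∈ A, ∑ b ∈ B, sgn (dotProduct a b)) ^ 2 ≤ (A.card * B.card : ℤ) * 2 ^ k := by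
  have h1 : ∑ a, (∑ b ∈ B, sgn (dotProduct a b)) ^ 2 = B.card * (2 : ℤ) ^ k := by
    simp only [sq, Finset.sum_mul_sum]
    rw [Finset.sum_comm]
    simp only [Finset.sum_comm (s := Finset.univ) (t := B), sum_sgn_mul_sgn]
    rw [Finset.sum_congr rfl fun b hb => by rw [Finset.sum_ite_eq, if_pos hb]]
    simp
  calc _ ≤ (A.card : ℤ) * ∑ a ∈ A, (∑ b ∈ B, sgn (dotProduct a b)) ^ 2 :=
        sq_sum_le_card_mul_sum_sq
    _ ≤ (A.card : ℤ) * ∑ a, (∑ b ∈ B, sgn (dotProduct a b)) ^ 2 := by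
        gcongr
        exact Finset.subset_univ A
    _ = _ := by rw [h1]; ring

/-- The annihilator of a family of vectors indexed by `s` has codimension at most `|s|`. -/
theorem two_pow_le_card_annihilator {k : ℕ} {ι : Type*} (s : Finset ι)
    (b : ι → Fin k → ZMod 2) :
    2 ^ k ≤ (Finset.univ.filter fun u => ∀ j ∈ s, dotProduct u (b j) = 0).card * 2 ^ s.card := by
  let f : (Fin k → ZMod 2) →+ (s → ZMod 2) :=
    { toFun := fun u j => dotProduct u (b j)
      map_zero' := funext fun j => zero_dotProduct _
      map_add' := fun u v => funext fun j => add_dotProduct _ _ _ }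
  have h1 := f.ker.card_mul_index
  rw [AddSubgroup.index_ker] at h1
  have h2 : Nat.card f.range ≤ 2 ^ s.card := by
    calc _ ≤ Nat.card (s → ZMod 2) := Nat.card_le_card_of_injective _ Subtype.val_injective
      _ = 2 ^ s.card := by
        rw [Nat.card_fun, Nat.card_zmod, Nat.card_eq_fintype_card, Fintype.card_coe]
  have h3 : Nat.card f.ker =
      (Finset.univ.filter fun u => ∀ j ∈ s, dotProduct u (b j) = 0).card := by
    rw [← Fintype.card_subtype, ← Nat.card_eq_fintype_card]
    refine Nat.card_congr (Equiv.subtypeEquivRight fun u => ?_)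
    rw [AddMonoidHom.mem_ker, funext_iff]
    exact Subtype.forall
  rw [h3] at h1
  calc 2 ^ k = Nat.card (Fin k → ZMod 2) := by simp
    _ ≤ _ := by rw [← h1]; gcongr

/-! ### Cliques in dense sets of pairs -/

/-- The common zeros of linear conditions on the two coordinates: after few conditions, many pairs
`(u, v)` with `⟨u, v⟩ = 1` remain. -/
theorem two_pow_le_card_uncovered {k : ℕ} {ι : Type*} (s : Finset ι) (a b : ι → Fin k → ZMod 2)
    (hs : 2 * s.card + 2 ≤ k) :
    ∃ U : Finset ((Fin k → ZMod 2) × (Fin k → ZMod 2)),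
      (∀ p ∈ U, dotProduct p.1 p.2 = 1 ∧
        ∀ j ∈ s, dotProduct p.1 (b j) = 0 ∧ dotProduct p.2 (a j) = 0) ∧
      2 ^ (2 * k) ≤ U.card * 2 ^ (2 * s.card + 2) := by
  have hA := two_pow_le_card_annihilator s b
  have hB := two_pow_le_card_annihilator s a
  set A := Finset.univ.filter fun u => ∀ j ∈ s, dotProduct u (b j) = 0 with hAdef
  set B := Finset.univ.filter fun u => ∀ j ∈ s, dotProduct u (a j) = 0 with hBdef
  set U := (A ×ˢ B).filter fun p => dotProduct p.1 p.2 = 1 with hU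
  have hUmem : ∀ p ∈ U, dotProduct p.1 p.2 = 1 ∧
      ∀ j ∈ s, dotProduct p.1 (b j) = 0 ∧ dotProduct p.2 (a j) = 0 := by
    intro p hp
    simp only [hU, hAdef, hBdef, Finset.mem_filter, Finset.mem_product, Finset.mem_univ,
      true_and] at hp
    exact ⟨hp.2, fun j hj => ⟨hp.1.1 j hj, hp.1.2 j hj⟩⟩
  have hsum : ∑ x ∈ A, ∑ y ∈ B, sgn (dotProduct x y) = (A.card * B.card : ℤ) - 2 * U.card := by
    have hsgn : ∀ c : ZMod 2, sgn c = 1 - 2 * (if c = 1 then 1 else 0) := by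
      unfold sgn; decide
    rw [← Finset.sum_product', hU]
    simp only [hsgn, Finset.sum_sub_distrib, ← Finset.mul_sum, Finset.sum_const,
      Finset.card_product, nsmul_eq_mul, mul_one, Finset.sum_boole, Nat.cast_mul]
  have hL := sq_sum_sgn_le A B
  rw [hsum] at hL
  have hAB : 2 ^ (2 * k) ≤ A.card * B.card * 2 ^ (2 * s.card) := by
    calc 2 ^ (2 * k) = 2 ^ k * 2 ^ k := by rw [two_mul, pow_add]
      _ ≤ (A.card * 2 ^ s.card) * (B.card * 2 ^ s.card) := Nat.mul_le_mul hA hB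
      _ = _ := by rw [two_mul, pow_add]; ring
  have h4 : 4 * 2 ^ k ≤ A.card * B.card := by
    refine Nat.le_of_mul_le_mul_right (c := 2 ^ (2 * s.card)) ?_ (by positivity)
    calc 4 * 2 ^ k * 2 ^ (2 * s.card) = 2 ^ (k + (2 * s.card + 2)) := by
          rw [pow_add, pow_add]; ring
      _ ≤ 2 ^ (2 * k) := Nat.pow_le_pow_right (by norm_num) (by omega)
      _ ≤ _ := hAB
  have hU4 : A.card * B.card ≤ 4 * U.card := by
    by_contra! hlt
    zify at h4 hlt
    -- otherwise the character sum exceeds half the size of the rectangle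
    nlinarith
  refine ⟨U, hUmem, ?_⟩
  calc 2 ^ (2 * k) ≤ A.card * B.card * 2 ^ (2 * s.card) := hAB
    _ ≤ 4 * U.card * 2 ^ (2 * s.card) := by gcongr
    _ = _ := by rw [pow_add]; ring

/-- Adjacency in the graph `G_k`, as a relation on arbitrary pairs of vectors. -/
def Biorth {k : ℕ} (p r : (Fin k → ZMod 2) × (Fin k → ZMod 2)) : Prop :=
  dotProduct p.1 r.2 = 0 ∧ dotProduct p.2 r.1 = 0

instance {k : ℕ} (p r : (Fin k → ZMod 2) × (Fin k → ZMod 2)) : Decidable (Biorth p r) :=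
  inferInstanceAs (Decidable (_ ∧ _))

theorem Biorth.symm {k : ℕ} {p r : (Fin k → ZMod 2) × (Fin k → ZMod 2)} (h : Biorth p r) :
    Biorth r p :=
  ⟨(dotProduct_comm _ _).trans h.2, (dotProduct_comm _ _).trans h.1⟩

theorem four_mul_ite_biorth {k : ℕ} (p r : (Fin k → ZMod 2) × (Fin k → ZMod 2)) :
    4 * (if Biorth p r then (1 : ℤ) else 0) =
      (1 + sgn (dotProduct p.1 r.2)) * (1 + sgn (dotProduct p.2 r.1)) := by
  have key : ∀ a b : ZMod 2,
      4 * (if a = 0 ∧ b = 0 then (1 : ℤ) else 0) = (1 + sgn a) * (1 + sgn b) := by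
    unfold sgn; decide
  rw [← key]
  rfl

theorem sum_one_add_sgn {k : ℕ} {v : Fin k → ZMod 2} (hv : v ≠ 0) :
    ∑ u, (1 + sgn (dotProduct u v)) = 2 ^ k := by
  rw [Finset.sum_add_distrib, sum_sgn_dotProduct hv]
  simp

theorem sum_one_add_sgn_mul {k : ℕ} {v v' : Fin k → ZMod 2} (hv : v ≠ 0) (hv' : v' ≠ 0) :
    ∑ u, (1 + sgn (dotProduct u v)) * (1 + sgn (dotProduct u v')) =
      2 ^ k * (1 + if v = v' then 1 else 0) := by
  have h : ∀ u, (1 + sgn (dotProduct u v)) * (1 + sgn (dotProduct u v')) =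
      (1 + sgn (dotProduct u v)) + sgn (dotProduct u v') +
        sgn (dotProduct u v) * sgn (dotProduct u v') := fun u => by ring
  simp only [h, Finset.sum_add_distrib (f := fun u => _ + _), sum_one_add_sgn hv,
    sum_sgn_dotProduct hv', sum_sgn_mul_sgn]
  split_ifs <;> ring

/-- The events "`p` is biorthogonal to `r`" and "`p` is biorthogonal to `r'`" are independent, for
uniform `p`, unless `r` and `r'` share a coordinate. -/
theorem sum_covariance_le {k : ℕ} {r r' : (Fin k → ZMod 2) × (Fin k → ZMod 2)}
    (h1 : r.1 ≠ 0) (h2 : r.2 ≠ 0) (h1' : r'.1 ≠ 0) (h2' : r'.2 ≠ 0) :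
    ∑ p, (4 * (if Biorth p r then (1 : ℤ) else 0) - 1) *
        (4 * (if Biorth p r' then (1 : ℤ) else 0) - 1) ≤
      2 ^ (2 * k) * (2 * (if r.1 = r'.1 then 1 else 0) + if r.2 = r'.2 then 1 else 0) := by
  have key : ∀ p : (Fin k → ZMod 2) × (Fin k → ZMod 2),
      (4 * (if Biorth p r then (1 : ℤ) else 0) - 1) *
        (4 * (if Biorth p r' then (1 : ℤ) else 0) - 1) =
      ((1 + sgn (dotProduct p.1 r.2)) * (1 + sgn (dotProduct p.1 r'.2))) *
        ((1 + sgn (dotProduct p.2 r.1)) * (1 + sgn (dotProduct p.2 r'.1))) -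
      (1 + sgn (dotProduct p.1 r.2)) * (1 + sgn (dotProduct p.2 r.1)) -
      (1 + sgn (dotProduct p.1 r'.2)) * (1 + sgn (dotProduct p.2 r'.1)) + 1 := by
    intro p
    rw [four_mul_ite_biorth, four_mul_ite_biorth]
    ring
  have hprod : ∀ f g : (Fin k → ZMod 2) → ℤ,
      ∑ p : (Fin k → ZMod 2) × (Fin k → ZMod 2), f p.1 * g p.2 = (∑ u, f u) * ∑ v, g v :=
    fun f g => by rw [Fintype.sum_prod_type, Finset.sum_mul_sum]
  rw [Finset.sum_congr rfl fun p _ => key p, Finset.sum_add_distrib, Finset.sum_sub_distrib,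
    Finset.sum_sub_distrib,
    hprod (fun u => (1 + sgn (dotProduct u r.2)) * (1 + sgn (dotProduct u r'.2)))
      (fun u => (1 + sgn (dotProduct u r.1)) * (1 + sgn (dotProduct u r'.1))),
    hprod (fun u => 1 + sgn (dotProduct u r.2)) (fun u => 1 + sgn (dotProduct u r.1)),
    hprod (fun u => 1 + sgn (dotProduct u r'.2)) (fun u => 1 + sgn (dotProduct u r'.1)),
    sum_one_add_sgn_mul h2 h2', sum_one_add_sgn_mul h1 h1', sum_one_add_sgn h1,
    sum_one_add_sgn h2, sum_one_add_sgn h1', sum_one_add_sgn h2']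
  have hc : ∑ _p : (Fin k → ZMod 2) × (Fin k → ZMod 2), (1 : ℤ) = 2 ^ (2 * k) := by
    simp [two_mul, pow_add]
  rw [hc, two_mul k, pow_add]
  have hpos : (0 : ℤ) < 2 ^ k * 2 ^ k := by positivity
  split_ifs <;> nlinarith

/-- Second moment bound for the number of elements of `R` biorthogonal to a pair `p`. -/
theorem sum_sq_deviation_le {k : ℕ} (R : Finset ((Fin k → ZMod 2) × (Fin k → ZMod 2)))
    (hR : ∀ r ∈ R, r.1 ≠ 0 ∧ r.2 ≠ 0) :
    ∑ p, (4 * ((R.filter (Biorth p)).card : ℤ) - R.card) ^ 2 ≤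
      (3 * 2 ^ (3 * k) * R.card : ℤ) := by
  have hdev : ∀ p, 4 * ((R.filter (Biorth p)).card : ℤ) - R.card =
      ∑ r ∈ R, (4 * (if Biorth p r then (1 : ℤ) else 0) - 1) := by
    intro p
    rw [Finset.sum_sub_distrib, ← Finset.mul_sum, Finset.card_filter]
    simp
  have hcard : (Finset.univ : Finset (Fin k → ZMod 2)).card = 2 ^ k := by simp
  have hfst : ∀ r : (Fin k → ZMod 2) × (Fin k → ZMod 2),
      ∑ r' ∈ R, (if r.1 = r'.1 then (1 : ℤ) else 0) ≤ 2 ^ k := by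
    intro r
    rw [Finset.sum_boole]
    have : (R.filter fun r' => r.1 = r'.1).card ≤ (Finset.univ : Finset (Fin k → ZMod 2)).card :=
      Finset.card_le_card_of_injOn Prod.snd (fun _ _ => Finset.mem_coe.2 (Finset.mem_univ _)) (by
        intro x hx y hy hxy
        exact Prod.ext ((Finset.mem_filter.1 hx).2.symm.trans (Finset.mem_filter.1 hy).2) hxy)
    rw [hcard] at this
    exact_mod_cast this
  have hsnd : ∀ r : (Fin k → ZMod 2) × (Fin k → ZMod 2),
      ∑ r' ∈ R, (if r.2 = r'.2 then (1 : ℤ) else 0) ≤ 2 ^ k := by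
    intro r
    rw [Finset.sum_boole]
    have : (R.filter fun r' => r.2 = r'.2).card ≤ (Finset.univ : Finset (Fin k → ZMod 2)).card :=
      Finset.card_le_card_of_injOn Prod.fst (fun _ _ => Finset.mem_coe.2 (Finset.mem_univ _)) (by
        intro x hx y hy hxy
        exact Prod.ext hxy ((Finset.mem_filter.1 hx).2.symm.trans (Finset.mem_filter.1 hy).2))
    rw [hcard] at this
    exact_mod_cast this
  calc ∑ p, (4 * ((R.filter (Biorth p)).card : ℤ) - R.card) ^ 2
      = ∑ r ∈ R, ∑ r' ∈ R, ∑ p, (4 * (if Biorth p r then (1 : ℤ) else 0) - 1) *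
          (4 * (if Biorth p r' then (1 : ℤ) else 0) - 1) := by
        simp only [hdev, sq, Finset.sum_mul_sum]
        rw [Finset.sum_comm]
        exact Finset.sum_congr rfl fun r _ => Finset.sum_comm
    _ ≤ ∑ r ∈ R, ∑ r' ∈ R, 2 ^ (2 * k) *
          (2 * (if r.1 = r'.1 then 1 else 0) + if r.2 = r'.2 then 1 else 0) :=
        Finset.sum_le_sum fun r hr => Finset.sum_le_sum fun r' hr' =>
          sum_covariance_le (hR r hr).1 (hR r hr).2 (hR r' hr').1 (hR r' hr').2
    _ ≤ ∑ r ∈ R, 3 * 2 ^ (3 * k) := by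
        refine Finset.sum_le_sum fun r _ => ?_
        rw [← Finset.mul_sum, Finset.sum_add_distrib, ← Finset.mul_sum]
        calc _ ≤ (2 : ℤ) ^ (2 * k) * (2 * 2 ^ k + 2 ^ k) := by
              gcongr
              · exact hfst r
              · exact hsnd r
          _ = _ := by rw [show 3 * k = 2 * k + k by ring, pow_add _ (2 * k) k]; ring
    _ = _ := by simp [mul_comm]

/-- A large set of pairs has a member biorthogonal to at least one eighth of the set. -/
theorem exists_card_le_eight_mul {k : ℕ} (R : Finset ((Fin k → ZMod 2) × (Fin k → ZMod 2)))
    (hR : ∀ r ∈ R, r.1 ≠ 0 ∧ r.2 ≠ 0) (hcard : 2 ^ (3 * k + 4) ≤ R.card ^ 2) :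
    ∃ p ∈ R, R.card ≤ 8 * (R.filter (Biorth p)).card := by
  by_contra! hlt
  have hRpos : (0 : ℤ) < R.card := by
    have : 0 < R.card ^ 2 := lt_of_lt_of_le (by positivity) hcard
    exact_mod_cast Nat.pos_of_ne_zero fun h => by simp [h] at this
  have h1 : (R.card : ℤ) * R.card ^ 2 ≤ 4 * (3 * 2 ^ (3 * k) * R.card) := by
    calc (R.card : ℤ) * R.card ^ 2 = ∑ p ∈ R, (R.card : ℤ) ^ 2 := by simp
      _ ≤ ∑ p ∈ R, 4 * (4 * ((R.filter (Biorth p)).card : ℤ) - R.card) ^ 2 := by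
          refine Finset.sum_le_sum fun p hp => ?_
          have h := hlt p hp
          zify at h
          have h0 : (0 : ℤ) ≤ (R.filter (Biorth p)).card := Int.natCast_nonneg _
          nlinarith
      _ = 4 * ∑ p ∈ R, (4 * ((R.filter (Biorth p)).card : ℤ) - R.card) ^ 2 := by
          rw [Finset.mul_sum]
      _ ≤ 4 * ∑ p, (4 * ((R.filter (Biorth p)).card : ℤ) - R.card) ^ 2 := by
          gcongr
          exact Finset.subset_univ R
      _ ≤ _ := by gcongr; exact sum_sq_deviation_le R hR
  have h2 : (R.card : ℤ) ^ 2 ≤ 12 * 2 ^ (3 * k) := by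
    refine le_of_mul_le_mul_left ?_ hRpos
    linarith
  have h3 : (2 : ℤ) ^ (3 * k + 4) ≤ R.card ^ 2 := by exact_mod_cast hcard
  rw [pow_add] at h3
  have : (0 : ℤ) < 2 ^ (3 * k) := by positivity
  linarith

/-- A set of pairs `(u, v)` with `⟨u, v⟩ = 1` that is much larger than `2 ^ (3k/2)` contains large
cliques of `G_k`: repeatedly pick a member biorthogonal to an eighth of what is left. -/
theorem exists_clique {k : ℕ} (t : ℕ) (R : Finset ((Fin k → ZMod 2) × (Fin k → ZMod 2)))
    (hR : ∀ r ∈ R, dotProduct r.1 r.2 = 1) (hcard : 2 ^ (3 * k + 4 + 6 * t) ≤ R.card ^ 2) :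
    ∃ s ⊆ R, s.card = t ∧ ∀ p ∈ s, ∀ r ∈ s, p ≠ r → Biorth p r := by
  induction t generalizing R with
  | zero => exact ⟨∅, by simp, rfl, by simp⟩
  | succ t ih =>
    have hne : ∀ r ∈ R, r.1 ≠ 0 ∧ r.2 ≠ 0 := fun r hr =>
      ⟨fun h => by simpa [h] using hR r hr, fun h => by simpa [h] using hR r hr⟩
    obtain ⟨p, hp, hp8⟩ := exists_card_le_eight_mul R hne
      ((Nat.pow_le_pow_right (by norm_num) (by omega)).trans hcard)
    obtain ⟨s, hsR, hst, hs⟩ := ih (R.filter (Biorth p))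
      (fun r hr => hR r (Finset.mem_filter.1 hr).1) (by
        refine Nat.le_of_mul_le_mul_left (c := 64) ?_ (by norm_num)
        calc 64 * 2 ^ (3 * k + 4 + 6 * t) = 2 ^ (3 * k + 4 + 6 * (t + 1)) := by
              rw [mul_add, ← add_assoc, pow_add _ (3 * k + 4 + 6 * t)]; ring
          _ ≤ _ := hcard
          _ ≤ (8 * (R.filter (Biorth p)).card) ^ 2 := Nat.pow_le_pow_left hp8 2
          _ = _ := by ring)
    have hps : p ∉ s := fun h => by
      have h0 := (Finset.mem_filter.1 (hsR h)).2.1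
      rw [hR p hp] at h0
      exact one_ne_zero h0
    refine ⟨insert p s, Finset.insert_subset hp (hsR.trans (Finset.filter_subset _ _)), ?_, ?_⟩
    · rw [Finset.card_insert_of_notMem hps, hst]
    · intro x hx y hy hxy
      rcases Finset.mem_insert.1 hx with hx | hx <;> rcases Finset.mem_insert.1 hy with hy | hy
      · exact absurd (hx.trans hy.symm) hxy
      · exact hx ▸ (Finset.mem_filter.1 (hsR hy)).2
      · exact hy ▸ (Finset.mem_filter.1 (hsR hx)).2.symm
      · exact hs x hx y hy hxy

/-! ### The complement of `G_k` -/

section Peeters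

variable {V : Type*} {G : SimpleGraph V} {k : ℕ}

theorem peeters_adj_iff (φ : G ≃g (peetersGraph k)ᶜ) (i j : V) :
    G.Adj i j ↔ i ≠ j ∧ ¬ Biorth (φ i).1 (φ j).1 := by
  rw [← φ.map_adj_iff, SimpleGraph.compl_adj, φ.injective.ne_iff]
  rfl

theorem represents_peeters (φ : G ≃g (peetersGraph k)ᶜ) :
    Represents G (fun i => (φ i).1.1) (fun i => (φ i).1.2) := by
  refine ⟨fun i => (φ i).2, fun i j hij hadj => ?_⟩
  rw [peeters_adj_iff φ, not_and, not_not] at hadj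
  exact (hadj hij).symm.1

/-- The vertex `(eᵢ, eᵢ)` of `G_k`. -/
def diagVertex (i : Fin k) :
    {p : (Fin k → ZMod 2) × (Fin k → ZMod 2) // dotProduct p.1 p.2 = 1} :=
  ⟨(Pi.single i 1, Pi.single i 1), by simp⟩

theorem diagVertex_injective : Function.Injective (diagVertex (k := k)) := by
  intro i j h
  have h1 : (Pi.single i 1 : Fin k → ZMod 2) = Pi.single j 1 := congrArg (fun p => p.1.1) h
  by_contra hij
  have := congrFun h1 i
  simp [hij] at this

theorem beta1_peeters (φ : G ≃g (peetersGraph k)ᶜ) : beta1 G = k := by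
  classical
  have := Fintype.ofEquiv _ φ.toEquiv.symm
  refine beta1_eq_of_represents (represents_peeters φ)
    (Finset.univ.image fun i => φ.symm (diagVertex i)) ?_ ?_
  · intro x hx y hy
    obtain ⟨i, -, rfl⟩ := Finset.mem_image.1 hx
    obtain ⟨j, -, rfl⟩ := Finset.mem_image.1 hy
    rw [peeters_adj_iff φ, not_and, not_not, φ.apply_symm_apply, φ.apply_symm_apply]
    intro hne
    have hij : i ≠ j := fun h => hne (by rw [h])
    simp [Biorth, diagVertex, hij]
  · exact (Finset.card_image_of_injective Finset.univ
      (φ.symm.injective.comp (diagVertex_injective (k := k)))).trans (by simp)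

/-- The vertices `(eᵢ, eᵢ)` dominate everything but themselves, and `(eᵢ, eᵢ + eⱼ)` with
`j = i + 1` (modulo `k`) dominates `(eᵢ, eᵢ)`; so `2k` senders suffice. -/
theorem exists_taskBasedCode_peeters (φ : G ≃g (peetersGraph k)ᶜ) (hk : 2 ≤ k) :
    ∃ C : TaskBasedCode G, C.totalLength ≤ 2 * k ^ 2 := by
  classical
  have := Finite.of_equiv _ φ.toEquiv.symm
  have : Fact (1 < k) := ⟨hk⟩
  have : NeZero k := ⟨by omega⟩
  have hne : ∀ i : Fin k, i + 1 ≠ i := fun i h => by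
    have h01 : (1 : Fin k) = 0 := by simpa using h
    have := congrArg Fin.val h01
    rw [Fin.val_one', Nat.mod_eq_of_lt hk] at this
    simp at this
  let w : Fin k → {p : (Fin k → ZMod 2) × (Fin k → ZMod 2) // dotProduct p.1 p.2 = 1} :=
    fun i => ⟨(Pi.single i 1, Pi.single i 1 + Pi.single (i + 1) 1), by
      simp [(hne i)]⟩
  let S : Finset V := Finset.univ.image (fun i => φ.symm (diagVertex i)) ∪
    Finset.univ.image (fun i => φ.symm (w i))
  obtain ⟨C, hC⟩ := (represents_peeters φ).exists_taskBasedCode S (by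
    intro x
    obtain ⟨i, hi⟩ : ∃ i, (φ x).1.1 i = 1 := by
      by_contra! h
      have hbit : ∀ c : ZMod 2, c ≠ 1 → c = 0 := by decide
      have h0 : (φ x).1.1 = 0 := funext fun i => hbit _ (h i)
      have := (φ x).2
      rw [h0] at this
      simp at this
    by_cases hx : φ x = diagVertex i
    · refine ⟨φ.symm (w i), Finset.mem_union_right _ (Finset.mem_image_of_mem _
        (Finset.mem_univ _)), ?_⟩
      rw [peeters_adj_iff φ, φ.apply_symm_apply, hx]
      refine ⟨fun h => ?_, by simp [Biorth, diagVertex, w]⟩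
      have h1 : w i = diagVertex i := by rw [← hx, ← h, φ.apply_symm_apply]
      have h2 := congrFun (congrArg (fun p => p.1.2) h1) (i + 1)
      simp [w, diagVertex, hne i] at h2
    · refine ⟨φ.symm (diagVertex i), Finset.mem_union_left _ (Finset.mem_image_of_mem _
        (Finset.mem_univ _)), ?_⟩
      rw [peeters_adj_iff φ, φ.apply_symm_apply]
      refine ⟨fun h => hx (by rw [← h, φ.apply_symm_apply]), ?_⟩
      simp [Biorth, diagVertex, hi])
  refine ⟨C, hC.trans_le ?_⟩
  calc S.card * k ≤ (k + k) * k := by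
        gcongr
        refine (Finset.card_union_le _ _).trans (add_le_add ?_ ?_) <;>
          exact Finset.card_image_le.trans (by simp)
    _ = _ := by ring

/-- The senders of at least `q` bits are fewer than `q` if the total length is below `q²`, hence they
leave many vertices to the other senders. Some sender of fewer than `q` bits then serves a set of
vertices large enough to contain an independent set of size `q`, which is impossible. -/
theorem sq_le_totalLength_peeters (φ : G ≃g (peetersGraph k)ᶜ) (C : TaskBasedCode G) (q : ℕ)
    (hq : 1 ≤ q) (hqk : 32 * q ≤ k) :
    q ^ 2 ≤ C.totalLength := by
  classical
  by_contra! hlt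
  let big : Finset C.S := Finset.univ.filter fun j => q ≤ C.len j
  let small : Finset C.S := Finset.univ.filter fun j => 1 ≤ C.len j ∧ C.len j < q
  have hbig : big.card + 1 ≤ q := by
    have h1 := C.card_mul_le_totalLength q
    have h2 : big.card * q < q * q := by rw [← sq]; exact h1.trans_lt hlt
    exact Nat.lt_of_mul_lt_mul_right h2
  have hsmall : small.card ≤ 2 ^ (2 * q) := by
    calc small.card ≤ (Finset.univ.filter fun j => 1 ≤ C.len j).card := by
          refine Finset.card_le_card fun j hj => ?_
          exact Finset.mem_filter.2 ⟨Finset.mem_univ _, (Finset.mem_filter.1 hj).2.1⟩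
      _ ≤ C.totalLength := by simpa using C.card_mul_le_totalLength 1
      _ ≤ q ^ 2 := hlt.le
      _ ≤ (2 ^ q) ^ 2 := Nat.pow_le_pow_left Nat.lt_two_pow_self.le 2
      _ = _ := by rw [← pow_mul, mul_comm]
  obtain ⟨U, hUmem, hU⟩ := two_pow_le_card_uncovered big (fun j => (φ j).1.1)
    (fun j => (φ j).1.2) (by omega)
  have hU1 : ∀ p ∈ U, dotProduct p.1 p.2 = 1 := fun p hp => (hUmem p hp).1
  have hUcard : 2 ^ (2 * k - 2 * q) ≤ U.card := by
    refine Nat.le_of_mul_le_mul_right (c := 2 ^ (2 * q)) ?_ (by positivity)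
    rw [← pow_add, Nat.sub_add_cancel (by omega)]
    exact hU.trans (Nat.mul_le_mul_left _ (Nat.pow_le_pow_right (by norm_num) (by omega)))
  obtain ⟨p₀, hp₀⟩ : U.Nonempty := Finset.card_pos.1 (lt_of_lt_of_le (by positivity) hUcard)
  -- the sender that serves a pair, extended by an arbitrary value
  let f : (Fin k → ZMod 2) × (Fin k → ZMod 2) → C.S := fun p =>
    if h : dotProduct p.1 p.2 = 1 then C.sender (φ.symm ⟨p, h⟩)
    else C.sender (φ.symm ⟨p₀, hU1 p₀ hp₀⟩)
  have hf : ∀ p (h : dotProduct p.1 p.2 = 1), f p = C.sender (φ.symm ⟨p, h⟩) :=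
    fun p h => dif_pos h
  have hmaps : ∀ p ∈ U, f p ∈ small := by
    intro p hp
    have h := hU1 p hp
    rw [hf p h]
    refine Finset.mem_filter.2 ⟨Finset.mem_univ _, C.one_le_len _, ?_⟩
    by_contra! hge
    have hadj := C.adj_sender (φ.symm ⟨p, h⟩)
    rw [peeters_adj_iff φ, φ.apply_symm_apply] at hadj
    have hb : C.sender (φ.symm ⟨p, h⟩) ∈ big := Finset.mem_filter.2 ⟨Finset.mem_univ _, hge⟩
    exact hadj.2 (Biorth.symm ((hUmem p hp).2 _ hb))
  obtain ⟨j, hj, hjcard⟩ := Finset.exists_le_card_fiber_of_mul_le_card_of_maps_to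
    (n := 2 ^ (2 * k - 4 * q)) hmaps ⟨_, hmaps p₀ hp₀⟩ (by
      calc small.card * 2 ^ (2 * k - 4 * q) ≤ 2 ^ (2 * q) * 2 ^ (2 * k - 4 * q) := by gcongr
        _ = 2 ^ (2 * k - 2 * q) := by rw [← pow_add]; congr 1; omega
        _ ≤ _ := hUcard)
  obtain ⟨s, hsub, hscard, hs⟩ := exists_clique q (U.filter fun p => f p = j)
    (fun r hr => hU1 r (Finset.mem_filter.1 hr).1) (by
      calc 2 ^ (3 * k + 4 + 6 * q) ≤ 2 ^ ((2 * k - 4 * q) * 2) :=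
            Nat.pow_le_pow_right (by norm_num) (by omega)
        _ = (2 ^ (2 * k - 4 * q)) ^ 2 := pow_mul _ _ _
        _ ≤ _ := Nat.pow_le_pow_left hjcard 2)
  have hs1 : ∀ p ∈ s, dotProduct p.1 p.2 = 1 :=
    fun p hp => hU1 p (Finset.mem_filter.1 (hsub hp)).1
  let g : s → V := fun p => φ.symm ⟨p, hs1 p p.2⟩
  have hg : Function.Injective g := fun p p' h =>
    Subtype.ext (Subtype.mk.inj (φ.symm.injective h))
  have hle := C.card_le_len j (Finset.univ.image g) (by
    intro x hx y hy
    obtain ⟨p, -, rfl⟩ := Finset.mem_image.1 hx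
    obtain ⟨r, -, rfl⟩ := Finset.mem_image.1 hy
    rw [peeters_adj_iff φ, not_and, not_not, φ.apply_symm_apply, φ.apply_symm_apply]
    exact fun hne => hs p p.2 r r.2 fun h => hne (congrArg g (Subtype.ext h))) (by
    intro x hx
    obtain ⟨p, -, rfl⟩ := Finset.mem_image.1 hx
    rw [← (Finset.mem_filter.1 (hsub p.2)).2, hf p (hs1 p p.2)])
  rw [Finset.card_image_of_injective _ hg, Finset.card_univ, Fintype.card_coe, hscard] at hle
  exact absurd (Finset.mem_filter.1 hj).2.2 (not_lt.2 hle)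

theorem isMinTaskBasedLength_peeters (φ : G ≃g (peetersGraph k)ᶜ) (hk : 2 ≤ k) :
    ∃ ℓ : ℕ, IsMinTaskBasedLength G ℓ ∧
      (1 / 4096 : ℝ) * (k : ℝ) ^ 2 ≤ (ℓ : ℝ) ∧ (ℓ : ℝ) ≤ 2 * (k : ℝ) ^ 2 := by
  obtain ⟨C, hC⟩ := exists_taskBasedCode_peeters φ hk
  obtain ⟨ℓ, hℓ⟩ := exists_isMinTaskBasedLength C
  refine ⟨ℓ, hℓ, ?_, by exact_mod_cast (hℓ.2 ⟨C, rfl⟩).trans hC⟩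
  obtain ⟨C', rfl⟩ := hℓ.1
  have hlow : k ^ 2 ≤ 4096 * C'.totalLength := by
    rcases lt_or_ge k 32 with hlt | hge
    · have h1 := C'.one_le_totalLength (φ.symm (diagVertex ⟨0, by omega⟩))
      nlinarith
    · have h1 := sq_le_totalLength_peeters φ C' (k / 32) (by omega) (by omega)
      have h2 : k ≤ 64 * (k / 32) := by omega
      calc k ^ 2 ≤ (64 * (k / 32)) ^ 2 := Nat.pow_le_pow_left h2 2
        _ = 4096 * (k / 32) ^ 2 := by ring
        _ ≤ _ := by gcongr
  have : (k : ℝ) ^ 2 ≤ 4096 * C'.totalLength := by exact_mod_cast hlow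
  show _ ≤ (C'.totalLength : ℝ)
  linarith

end Peeters

theorem exists_graph_peeters {k : ℕ} (hk : 2 ≤ k) :
    ∃ (n : ℕ) (G : SimpleGraph (Fin n)), beta1 G = k ∧
      ∃ ℓ : ℕ, IsMinTaskBasedLength G ℓ ∧
        (1 / 4096 : ℝ) * (k : ℝ) ^ 2 ≤ (ℓ : ℝ) ∧ (ℓ : ℝ) ≤ 2 * (k : ℝ) ^ 2 := by
  have φ := SimpleGraph.Iso.comap
    (Finite.equivFin {p : (Fin k → ZMod 2) × (Fin k → ZMod 2) // dotProduct p.1 p.2 = 1}).symm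
    (peetersGraph k)ᶜ
  exact ⟨_, _, beta1_peeters φ, isMinTaskBasedLength_peeters φ hk⟩

theorem exists_graph_zero :
    ∃ (n : ℕ) (G : SimpleGraph (Fin n)), beta1 G = 0 ∧ IsMinTaskBasedLength G 0 := by
  have hab : Represents (⊥ : SimpleGraph (Fin 0)) (k := 0) 0 0 :=
    ⟨fun i => i.elim0, fun i => i.elim0⟩
  obtain ⟨C, hC⟩ := hab.exists_taskBasedCode ∅ fun i => i.elim0
  exact ⟨0, ⊥, beta1_eq_of_represents hab ∅ (by simp) rfl, ⟨C, by simpa using hC⟩,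
    fun _ _ => Nat.zero_le _⟩

/-- The complement of `G₁` is a single vertex, which has no task-based code; two adjacent vertices
serve instead. -/
theorem exists_graph_one :
    ∃ (n : ℕ) (G : SimpleGraph (Fin n)), beta1 G = 1 ∧
      ∃ ℓ : ℕ, IsMinTaskBasedLength G ℓ ∧ 1 ≤ ℓ ∧ ℓ ≤ 2 := by
  have hab : Represents (⊤ : SimpleGraph (Fin 2)) (k := 1) (fun _ _ => 1) (fun _ _ => 1) :=
    ⟨fun i => by simp [dotProduct], fun i j hij h => absurd ((SimpleGraph.top_adj i j).2 hij) h⟩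
  obtain ⟨C, hC⟩ := hab.exists_taskBasedCode Finset.univ fun i =>
    (exists_ne i).imp fun j hj => ⟨Finset.mem_univ _, (SimpleGraph.top_adj j i).2 hj⟩
  obtain ⟨ℓ, hℓ⟩ := exists_isMinTaskBasedLength C
  refine ⟨2, ⊤, beta1_eq_of_represents hab {0} (by simp) rfl, ℓ, hℓ, ?_, ?_⟩
  · obtain ⟨C', rfl⟩ := hℓ.1
    exact C'.one_le_totalLength 0
  · exact (hℓ.2 ⟨C, rfl⟩).trans (by simp [hC])

theorem mainTheorem3 :
    ∃ c C : ℝ, 0 < c ∧ 0 < C ∧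
      (∀ k : ℕ, ∃ (n : ℕ) (G : SimpleGraph (Fin n)), beta1 G = k ∧
        ∃ ℓ : ℕ, IsMinTaskBasedLength G ℓ ∧
          c * (k : ℝ) ^ 2 ≤ (ℓ : ℝ) ∧ (ℓ : ℝ) ≤ C * (k : ℝ) ^ 2) ∧
      (∀ k : ℕ, 2 ≤ k → beta1 (peetersGraph k)ᶜ = k ∧
        ∃ ℓ : ℕ, IsMinTaskBasedLength (peetersGraph k)ᶜ ℓ ∧
          c * (k : ℝ) ^ 2 ≤ (ℓ : ℝ) ∧ (ℓ : ℝ) ≤ C * (k : ℝ) ^ 2) := by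
  refine ⟨1 / 4096, 2, by norm_num, by norm_num, fun k => ?_, fun k hk =>
    ⟨beta1_peeters SimpleGraph.Iso.refl, isMinTaskBasedLength_peeters SimpleGraph.Iso.refl hk⟩⟩
  match k with
  | 0 =>
    obtain ⟨n, G, hβ, hℓ⟩ := exists_graph_zero
    exact ⟨n, G, hβ, 0, hℓ, by simp, by simp⟩
  | 1 =>
    obtain ⟨n, G, hβ, ℓ, hℓ, h1, h2⟩ := exists_graph_one
    have h1' : (1 : ℝ) ≤ ℓ := by exact_mod_cast h1
    have h2' : (ℓ : ℝ) ≤ 2 := by exact_mod_cast h2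
    exact ⟨n, G, hβ, ℓ, hℓ, by norm_num; linarith, by simpa using h2'⟩
  | k + 2 => exact exists_graph_peeters (by omega)
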